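/- Let $\mathscr A$ be a nonzero unital complex $C^*$-algebra, and let $S_{\mathscr A}$ be its set of states, i.e. of linear functionals $\phi:\mathscr A\to\mathbb C$ with $\phi(1_{\mathscr A})=1$ that take positive elements to non-negative real numbers. Let $\mathscr E$ be a Hilbert $C^*$-module over $\mathscr A$ (inner product linear in the second variable), let $\mathscr F$ be a complex linear subspace of $\mathscr E$, not necessarily closed, let $e\in\mathscr E$, and let $f_0$ be a best approximation to $e$ in $\mathscr F$, i.e. $f_0\in\mathscr F$ and $\|e-f_0\|\le\|e-f\|$ for all $f\in\mathscr F$. For $\phi\in S_{\mathscr A}$ let $\mathscr L=\{x\in\mathscr E:\phi(\langle x|x\rangle)=0\}$, equip $\mathscr E/\mathscr L$ with the inner product $\langle x+\mathscr L|y+\mathscr L\rangle=\phi(\langle x|y\rangle)$, let $\mathscr F/\mathscr L$ be the image of $\mathscr F$ in $\mathscr E/\mathscr L$, and put $$M_{e,\mathscr F}(\phi)=\sup\Big\{\phi(\langle e-f_0|e-f_0\rangle)-\sum_\alpha|\phi(\langle e-f_0|f_\alpha\rangle)|^2\Big\},$$ where the supremum is taken over all orthonormal bases $\{f_\alpha+\mathscr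 L\}$ $(f_\alpha\in\mathscr F)$ of $\mathscr F/\mathscr L$, an orthonormal basis of an inner product space being a maximal orthonormal subset. Then $$\operatorname{dist}(e,\mathscr F)^2=\max\{M_{e,\mathscr F}(\phi):\phi\in S_{\mathscr A}\},$$ where $\operatorname{dist}(e,\mathscr F)=\inf\{\|e-f\|:f\in\mathscr F\}$; in particular the maximum is attained. -/

import Mathlib

open scoped ComplexOrder InnerProductSpace

/-- The set of states of a unital C⋆-algebra: the positive linear functionals `φ` with
`φ 1 = 1`. -/
def CStarState (A : Type*) [CStarAlgebra A] [PartialOrder A] [StarOrderedRing A] :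
    Set (A →ₚ[ℂ] ℂ) :=
  {φ | φ 1 = 1}

/-- `f₀` is a best approximation to `e` in the subspace `F`. -/
def IsBestApproximation {E : Type*} [NormedAddCommGroup E] [NormedSpace ℂ E]
    (F : Submodule ℂ E) (e f₀ : E) : Prop :=
  f₀ ∈ F ∧ ∀ f ∈ F, ‖e - f₀‖ ≤ ‖e - f‖

section StateSpace

variable {A : Type*} [CStarAlgebra A] [PartialOrder A] [StarOrderedRing A] (φ : A →ₚ[ℂ] ℂ)
  (E : Type*) [NormedAddCommGroup E] [NormedSpace ℂ E] [SMul A E] [CStarModule A E]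

/-- The semi-inner product `(x, y) ↦ φ ⟪x, y⟫` on a Hilbert C⋆-module. -/
noncomputable abbrev statePreInner : PreInnerProductSpace.Core ℂ E where
  inner x y := φ ⟪x, y⟫_A
  conj_inner_symm x y := by
    rw [← Complex.star_def, ← map_star φ, CStarModule.star_inner]
  re_inner_nonneg x :=
    (RCLike.nonneg_iff.mp (φ.map_nonneg (CStarModule.inner_self_nonneg (A := A)))).1
  add_left x y z := by rw [CStarModule.inner_add_left, map_add]
  smul_left x y r := by
    rw [CStarModule.inner_smul_left_complex, map_smul]; rfl

/-- Cauchy-Schwarz for the semi-inner product, in the degenerate case. -/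
theorem state_inner_eq_zero {x : E} (hx : φ ⟪x, x⟫_A = 0) (y : E) : φ ⟪x, y⟫_A = 0 := by
  have h := @InnerProductSpace.Core.inner_mul_inner_self_le ℂ E _ _ _ (statePreInner φ E) x y
  change ‖φ ⟪x, y⟫_A‖ * ‖φ ⟪y, x⟫_A‖ ≤ (φ ⟪x, x⟫_A).re * (φ ⟪y, y⟫_A).re at h
  have hs : ‖φ ⟪y, x⟫_A‖ = ‖φ ⟪x, y⟫_A‖ := by
    rw [← CStarModule.star_inner x y, map_star, norm_star]
  rw [hx, hs] at h
  simp only [Complex.zero_re, zero_mul] at h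
  have h0 := norm_nonneg (φ ⟪x, y⟫_A)
  exact norm_eq_zero.mp (by nlinarith)

theorem state_inner_eq_zero' {x : E} (hx : φ ⟪x, x⟫_A = 0) (y : E) : φ ⟪y, x⟫_A = 0 := by
  rw [← CStarModule.star_inner x y, map_star, state_inner_eq_zero φ E hx, star_zero]

/-- The subspace `{x | φ ⟪x, x⟫ = 0}` of a Hilbert C⋆-module. -/
def stateKer : Submodule ℂ E where
  carrier := {x | φ ⟪x, x⟫_A = 0}
  zero_mem' := by simp
  add_mem' {x y} hx hy := by
    simp only [Set.mem_ofPred_eq] at hx hy ⊢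
    rw [CStarModule.inner_add_left, map_add, state_inner_eq_zero' φ E, state_inner_eq_zero' φ E,
      add_zero]
    all_goals
      rw [CStarModule.inner_add_right, map_add]
      simp [hx, hy, state_inner_eq_zero φ E hx, state_inner_eq_zero φ E hy]
  smul_mem' c x hx := by
    simp only [Set.mem_ofPred_eq] at hx ⊢
    rw [CStarModule.inner_smul_right_complex, CStarModule.inner_smul_left_complex, map_smul,
      map_smul, hx, smul_zero, smul_zero]

/-- The quotient of a Hilbert C⋆-module by `{x | φ ⟪x, x⟫ = 0}`. It is given its own name so that
it carries the norm of the inner product induced by `φ`, and not the quotient norm. -/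
def StateQuotient : Type _ := E ⧸ stateKer φ E

noncomputable instance : AddCommGroup (StateQuotient φ E) :=
  inferInstanceAs (AddCommGroup (E ⧸ stateKer φ E))

noncomputable instance : Module ℂ (StateQuotient φ E) :=
  inferInstanceAs (Module ℂ (E ⧸ stateKer φ E))

/-- The quotient map `x ↦ x + L`. -/
noncomputable def stateMk : E →ₗ[ℂ] StateQuotient φ E := (stateKer φ E).mkQ

/-- The inner product `⟪x + L, y + L⟫ = φ ⟪x, y⟫` on the quotient. -/
noncomputable abbrev stateInnerCore : InnerProductSpace.Core ℂ (StateQuotient φ E) where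
  inner := Quotient.lift₂ (fun x y : E => φ ⟪x, y⟫_A) (by
    intro a b c d hac hbd
    have h1 : φ ⟪a - c, a - c⟫_A = 0 := (Submodule.quotientRel_def _).mp hac
    have h2 : φ ⟪b - d, b - d⟫_A = 0 := (Submodule.quotientRel_def _).mp hbd
    have e1 := state_inner_eq_zero φ E h1 b
    have e2 := state_inner_eq_zero' φ E h2 c
    rw [CStarModule.inner_sub_left, map_sub, sub_eq_zero] at e1
    rw [CStarModule.inner_sub_right, map_sub, sub_eq_zero] at e2
    exact e1.trans e2)
  conj_inner_symm := by
    rintro ⟨x⟩ ⟨y⟩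
    exact (statePreInner φ E).conj_inner_symm x y
  re_inner_nonneg := by
    rintro ⟨x⟩
    exact (statePreInner φ E).re_inner_nonneg x
  add_left := by
    rintro ⟨x⟩ ⟨y⟩ ⟨z⟩
    exact (statePreInner φ E).add_left x y z
  smul_left := by
    rintro ⟨x⟩ ⟨y⟩ r
    exact (statePreInner φ E).smul_left x y r
  definite := by
    rintro ⟨x⟩ h
    exact (Submodule.Quotient.mk_eq_zero (stateKer φ E)).mpr h

noncomputable instance : NormedAddCommGroup (StateQuotient φ E) :=
  (stateInnerCore φ E).toNormedAddCommGroup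

noncomputable instance : InnerProductSpace ℂ (StateQuotient φ E) :=
  InnerProductSpace.ofCore (stateInnerCore φ E).toCore

noncomputable instance : Inner ℂ (StateQuotient φ E) := InnerProductSpace.toInner

variable {E}

theorem state_inner_mk (x y : E) : ⟪stateMk φ E x, stateMk φ E y⟫_ℂ = φ ⟪x, y⟫_A := rfl

/-- `S` is an orthonormal basis of `F/L` in `E/L`: a maximal orthonormal subset of the image of
`F` in `E/L`. -/
def IsOrthonormalBasisOfImage (F : Submodule ℂ E) (S : Set (StateQuotient φ E)) : Prop :=
  Maximal (fun T : Set (StateQuotient φ E) =>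
    T ⊆ F.map (stateMk φ E) ∧ Orthonormal ℂ ((↑) : T → StateQuotient φ E)) S

/-- The numbers `φ ⟪e - f₀, e - f₀⟫ - ∑ |φ ⟪e - f₀, f_α⟫|²`, one for each orthonormal basis
`{f_α + L}` of `F/L` in `E/L`; here `φ ⟪e - f₀, f_α⟫` is `⟪(e - f₀) + L, f_α + L⟫`. -/
def stateDefects (F : Submodule ℂ E) (e f₀ : E) : Set ℝ :=
  {r | ∃ S : Set (StateQuotient φ E), IsOrthonormalBasisOfImage φ F S ∧
    r = (φ ⟪e - f₀, e - f₀⟫_A).re -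
      ∑' u : S, ‖⟪stateMk φ E (e - f₀), (u : StateQuotient φ E)⟫_ℂ‖ ^ 2}

/-- The quantity `M_{e,F}(φ)`, formed with the best approximation `f₀`: the supremum of
`φ ⟪e - f₀, e - f₀⟫ - ∑ |φ ⟪e - f₀, f_α⟫|²` over all orthonormal bases of `F/L`. -/
noncomputable def stateM (F : Submodule ℂ E) (e f₀ : E) : ℝ :=
  sSup (stateDefects φ F e f₀)

/-- An orthonormal basis exists, so the supremum is over a nonempty set. -/
theorem stateDefects_nonempty (F : Submodule ℂ E) (e f₀ : E) :
    (stateDefects φ F e f₀).Nonempty := by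
  obtain ⟨S, -, hS⟩ := zorn_subset_nonempty
    {T : Set (StateQuotient φ E) |
      T ⊆ F.map (stateMk φ E) ∧ Orthonormal ℂ ((↑) : T → StateQuotient φ E)}
    (fun c hc cc _ => ⟨⋃₀ c, ⟨Set.sUnion_subset fun t ht => (hc ht).1,
      orthonormal_sUnion_of_directed cc.directedOn fun t ht => (hc ht).2⟩,
      fun _ => Set.subset_sUnion_of_mem⟩)
    ∅ ⟨Set.empty_subset _, by simp [Orthonormal, Pairwise]⟩
  exact ⟨_, S, hS, rfl⟩

/-- The sums in `stateDefects` converge. -/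
theorem summable_state_inner (F : Submodule ℂ E) (x : E) {S : Set (StateQuotient φ E)}
    (hS : IsOrthonormalBasisOfImage φ F S) :
    Summable fun u : S => ‖⟪stateMk φ E x, (u : StateQuotient φ E)⟫_ℂ‖ ^ 2 := by
  refine (hS.prop.2.inner_products_summable (stateMk φ E x)).congr fun u => ?_
  rw [norm_inner_symm]

/-- The supremum in `stateM` is over a set that is bounded above. -/
theorem stateDefects_bddAbove (F : Submodule ℂ E) (e f₀ : E) :
    BddAbove (stateDefects φ F e f₀) := by
  refine ⟨(φ ⟪e - f₀, e - f₀⟫_A).re, ?_⟩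
  rintro r ⟨S, -, rfl⟩
  exact sub_le_self _ (tsum_nonneg fun _ => sq_nonneg _)

end StateSpace

/-! With `x = e - f₀`, every number in `stateDefects φ F e f₀` is at most `φ ⟪x, x⟫ ≤ ‖x‖ ^ 2`, so
it is enough to find a state `φ` with `φ ⟪x, x⟫ = ‖x‖ ^ 2` and `φ ⟪x, f⟫ = 0` for `f ∈ F`, that is, a
state annihilating the subspace `V` spanned by `b = ‖x‖ ^ 2 - ⟪x, x⟫ ≥ 0` and `⟪x, F⟫`. By
Hahn–Banach, and because contractive unital functionals are positive, such a state exists as soon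
as `V` has distance `1` from the unit. If `‖1 - (t b + ⟪x, f⟫)‖ < 1`, then the real part of
`t b + ⟪x, f⟫` is bounded below by a positive scalar, and expanding `⟪x - s f, x - s f⟫` for small
`s > 0` gives `‖x - s f‖ < ‖x‖`, against the minimality of `x`. -/

section HahnBanach

variable {𝕜 E : Type*} [RCLike 𝕜] [SeminormedAddCommGroup E] [NormedSpace 𝕜 E]

theorem exists_strongDual_apply_eq_infDist (V : Submodule 𝕜 E) (x : E) :
    ∃ g : StrongDual 𝕜 E, ‖g‖ ≤ 1 ∧ g x = Metric.infDist x (V : Set E) ∧ ∀ v ∈ V, g v = 0 := by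
  obtain ⟨g, hg, hgx⟩ := exists_dual_vector'' 𝕜 (V.mkQ x)
  refine ⟨g ∘L V.mkQL, ?_, ?_, fun v hv => ?_⟩
  · refine ContinuousLinearMap.opNorm_le_bound _ zero_le_one fun y => ?_
    exact g.le_of_opNorm_le_of_le hg (Submodule.Quotient.norm_mk_le V y)
  · exact hgx.trans (congrArg _ (QuotientAddGroup.norm_mk (S := V.toAddSubgroup) x))
  · change g (V.mkQ v) = 0
    rw [Submodule.mkQ_apply, (Submodule.Quotient.mk_eq_zero V).mpr hv, map_zero]

end HahnBanach

section UnitalFunctionals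

variable {A : Type*} [NormedRing A] [StarRing A] [CStarRing A] [NormedAlgebra ℂ A] [StarModule ℂ A]

theorem norm_add_I_mul_smul_one_sq_le {a : A} (ha : IsSelfAdjoint a) (t : ℝ) :
    ‖a + (Complex.I * t) • (1 : A)‖ ^ 2 ≤ ‖a‖ ^ 2 + t ^ 2 := by
  obtain _ | _ := subsingleton_or_nontrivial A
  · rw [Subsingleton.elim (a + _) 0, norm_zero, zero_pow two_ne_zero]
    positivity
  have hstar : star (Complex.I * t) = -(Complex.I * t) := by simp
  have hsq : -(Complex.I * t) * (Complex.I * t) = (t ^ 2 : ℝ) := by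
    linear_combination (norm := (push_cast; ring)) -(t : ℂ) ^ 2 * Complex.I_sq
  have hexpand : star (a + (Complex.I * t) • (1 : A)) * (a + (Complex.I * t) • (1 : A)) =
      a * a + (t ^ 2) • (1 : A) := by
    rw [star_add, star_smul, star_one, ha.star_eq, hstar, ← Complex.coe_smul (t ^ 2), ← hsq]
    simp only [mul_add, add_mul, smul_mul_assoc, mul_smul_comm, one_mul, mul_one]
    module
  calc ‖a + (Complex.I * t) • (1 : A)‖ ^ 2 = ‖a * a + (t ^ 2) • (1 : A)‖ := by
        rw [← hexpand, CStarRing.norm_star_mul_self, sq]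
    _ ≤ ‖a‖ * ‖a‖ + ‖(t ^ 2) • (1 : A)‖ := norm_add_le_of_le (norm_mul_le a a) le_rfl
    _ = ‖a‖ ^ 2 + t ^ 2 := by
        rw [norm_smul, norm_one, mul_one, Real.norm_of_nonneg (sq_nonneg t), sq ‖a‖]

theorem im_apply_eq_zero_of_norm_le_one_of_map_one {g : StrongDual ℂ A} (hg : ‖g‖ ≤ 1)
    (hg1 : g 1 = 1) {a : A} (ha : IsSelfAdjoint a) : (g a).im = 0 := by
  have hbound (t : ℝ) : (g a).im ^ 2 + 2 * t * (g a).im ≤ ‖a‖ ^ 2 := by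
    have hsq : ((g a).im + t) ^ 2 ≤ ‖a‖ ^ 2 + t ^ 2 :=
      calc ((g a).im + t) ^ 2 = |(g (a + (Complex.I * t) • (1 : A))).im| ^ 2 := by simp [hg1]
        _ ≤ ‖g (a + (Complex.I * t) • (1 : A))‖ ^ 2 := by gcongr; exact Complex.abs_im_le_norm _
        _ ≤ (1 * ‖a + (Complex.I * t) • (1 : A)‖) ^ 2 := by gcongr; exact g.le_of_opNorm_le hg _
        _ ≤ ‖a‖ ^ 2 + t ^ 2 := by
            rw [one_mul]
            exact norm_add_I_mul_smul_one_sq_le ha t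
    linarith
  by_contra hne
  have hcancel : 2 * (‖a‖ ^ 2 / (2 * (g a).im)) * (g a).im = ‖a‖ ^ 2 := by field_simp
  linarith [hbound (‖a‖ ^ 2 / (2 * (g a).im)), sq_pos_of_ne_zero hne]

end UnitalFunctionals

section States

variable {A : Type*} [CStarAlgebra A] [PartialOrder A] [StarOrderedRing A]

theorem apply_nonneg_of_norm_le_one_of_map_one {g : StrongDual ℂ A} (hg : ‖g‖ ≤ 1)
    (hg1 : g 1 = 1) {a : A} (ha : 0 ≤ a) : 0 ≤ g a := by
  have hre : |‖a‖ - (g a).re| ≤ ‖a‖ := by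
    calc |‖a‖ - (g a).re| = |(g (algebraMap ℝ A ‖a‖ - a)).re| := by
          simp [Algebra.algebraMap_eq_smul_one, ContinuousLinearMap.map_smul_of_tower, hg1]
      _ ≤ ‖g (algebraMap ℝ A ‖a‖ - a)‖ := Complex.abs_re_le_norm _
      _ ≤ 1 * ‖algebraMap ℝ A ‖a‖ - a‖ := g.le_of_opNorm_le hg _
      _ ≤ ‖a‖ := by
          have hdiff : 0 ≤ algebraMap ℝ A ‖a‖ - a :=
            sub_nonneg.mpr (IsSelfAdjoint.of_nonneg ha).le_algebraMap_norm_self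
          rw [one_mul, CStarAlgebra.norm_le_iff_le_algebraMap _ (norm_nonneg a) hdiff]
          exact sub_le_self _ ha
  have him : (g a).im = 0 := im_apply_eq_zero_of_norm_le_one_of_map_one hg hg1 (.of_nonneg ha)
  exact Complex.nonneg_iff.mpr ⟨by linarith [(abs_le.mp hre).2], him.symm⟩

theorem exists_state_forall_apply_eq_zero (V : Submodule ℂ A)
    (hV : Metric.infDist 1 (V : Set A) = 1) : ∃ φ ∈ CStarState A, ∀ a ∈ V, φ a = 0 := by
  obtain ⟨g, hg, hg1, hgV⟩ := exists_strongDual_apply_eq_infDist V 1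
  rw [hV, RCLike.ofReal_one] at hg1
  exact ⟨.mk₀ (g : A →ₗ[ℂ] ℂ) fun _ => apply_nonneg_of_norm_le_one_of_map_one hg hg1, hg1, hgV⟩

theorem CStarState.apply_algebraMap {φ : A →ₚ[ℂ] ℂ} (hφ : φ ∈ CStarState A) (r : ℝ) :
    φ (algebraMap ℝ A r) = r := by
  have hφ1 : φ 1 = 1 := hφ
  simp [Algebra.algebraMap_eq_smul_one, PositiveLinearMap.map_smul_of_tower, hφ1]

end States

section OrderNorm

variable {A : Type*} [CStarAlgebra A] [PartialOrder A] [StarOrderedRing A]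

theorem norm_le_of_le_algebraMap [Nontrivial A] {a : A} (ha : 0 ≤ a) {r : ℝ}
    (h : a ≤ algebraMap ℝ A r) : ‖a‖ ≤ r :=
  (le_algebraMap_iff_spectrum_le (ha := .of_nonneg ha)).mp h _
    (CStarAlgebra.norm_mem_spectrum_of_nonneg ha)

theorem algebraMap_le_add_star_self (a : A) :
    algebraMap ℝ A (2 * (1 - ‖1 - a‖)) ≤ a + star a := by
  have hnorm : ‖(1 - a) + star (1 - a)‖ ≤ 2 * ‖1 - a‖ :=
    (norm_add_le _ _).trans_eq (by rw [norm_star, two_mul])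
  have hle : (1 - a) + star (1 - a) ≤ algebraMap ℝ A (2 * ‖1 - a‖) :=
    (IsSelfAdjoint.add_star_self (1 - a)).le_algebraMap_norm_self.trans (algebraMap_mono A hnorm)
  rw [← sub_nonneg] at hle ⊢
  refine hle.trans_eq ?_
  rw [star_sub, star_one]
  simp only [Algebra.algebraMap_eq_smul_one]
  module

end OrderNorm

section HilbertModule

variable {A : Type*} [CStarAlgebra A] [PartialOrder A] [StarOrderedRing A]
  {E : Type*} [NormedAddCommGroup E] [NormedSpace ℂ E] [SMul A E] [CStarModule A E]

theorem inner_self_le_algebraMap_norm_sq (x : E) : ⟪x, x⟫_A ≤ algebraMap ℝ A (‖x‖ ^ 2) := by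
  rw [CStarModule.norm_sq_eq A]
  exact CStarModule.isSelfAdjoint_inner_self.le_algebraMap_norm_self

theorem CStarState.re_apply_inner_self_le_norm_sq {φ : A →ₚ[ℂ] ℂ} (hφ : φ ∈ CStarState A)
    (x : E) : (φ ⟪x, x⟫_A).re ≤ ‖x‖ ^ 2 := by
  have h := φ.monotone' (inner_self_le_algebraMap_norm_sq (A := A) x)
  exact (Complex.le_def.mp (h.trans_eq (CStarState.apply_algebraMap hφ _))).1

theorem inner_sub_smul_self_le {x f : E} {t δ s : ℝ}
    (hδ : algebraMap ℝ A δ ≤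
      t • (algebraMap ℝ A (‖x‖ ^ 2) - ⟪x, x⟫_A) + (⟪x, f⟫_A + ⟪f, x⟫_A))
    (hs : 0 ≤ s) (hst : s * t ≤ 1) :
    ⟪x - s • f, x - s • f⟫_A ≤ algebraMap ℝ A (‖x‖ ^ 2 - s * δ + s ^ 2 * ‖f‖ ^ 2) := by
  have hexpand : ⟪x - s • f, x - s • f⟫_A =
      ⟪x, x⟫_A - s • (⟪x, f⟫_A + ⟪f, x⟫_A) + s ^ 2 • ⟪f, f⟫_A := by
    simp only [CStarModule.inner_sub_left, CStarModule.inner_sub_right,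
      CStarModule.inner_smul_left_real, CStarModule.inner_smul_right_real]
    module
  -- The sum of the next three bounds trades `s t ⟪x, x⟫` for `s t ‖x‖ ^ 2`, and then bounds the
  -- remaining `(1 - s t) ⟪x, x⟫`, whose coefficient is nonnegative.
  have hcross := smul_le_smul_of_nonneg_left hδ hs
  have hx := smul_le_smul_of_nonneg_left (inner_self_le_algebraMap_norm_sq (A := A) x)
    (sub_nonneg.mpr hst)
  have hf := smul_le_smul_of_nonneg_left (inner_self_le_algebraMap_norm_sq (A := A) f) (sq_nonneg s)
  have hsum := add_le_add (add_le_add hcross hx) hf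
  rw [hexpand]
  simp only [Algebra.algebraMap_eq_smul_one] at hsum ⊢
  rw [← sub_nonneg] at hsum ⊢
  exact hsum.trans_eq (by module)

variable [Nontrivial A]

open Filter Topology in
theorem nonpos_of_forall_norm_le_norm_sub_smul {x f : E} (hx : ∀ s : ℝ, ‖x‖ ≤ ‖x - s • f‖)
    {t δ : ℝ} (hδ : algebraMap ℝ A δ ≤
      t • (algebraMap ℝ A (‖x‖ ^ 2) - ⟪x, x⟫_A) + (⟪x, f⟫_A + ⟪f, x⟫_A)) : δ ≤ 0 := by
  have hsmall : ∀ᶠ s : ℝ in 𝓝[>] 0, s * t ≤ 1 := by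
    have hlim : Tendsto (fun s : ℝ => s * t) (𝓝[>] 0) (𝓝 (0 * t)) :=
      (tendsto_id.mul_const t).mono_left nhdsWithin_le_nhds
    exact hlim.eventually_le_const (by simp)
  have hle : ∀ᶠ s : ℝ in 𝓝[>] 0, δ ≤ s * ‖f‖ ^ 2 := by
    filter_upwards [hsmall, self_mem_nhdsWithin] with s hst (hs : 0 < s)
    have hupper : ‖x - s • f‖ ^ 2 ≤ ‖x‖ ^ 2 - s * δ + s ^ 2 * ‖f‖ ^ 2 := by
      rw [CStarModule.norm_sq_eq A]
      exact norm_le_of_le_algebraMap CStarModule.inner_self_nonneg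
        (inner_sub_smul_self_le hδ hs.le hst)
    have hlower : ‖x‖ ^ 2 ≤ ‖x - s • f‖ ^ 2 := by gcongr; exact hx s
    exact le_of_mul_le_mul_left (by linarith) hs
  have hlim : Tendsto (fun s : ℝ => s * ‖f‖ ^ 2) (𝓝[>] 0) (𝓝 (0 * ‖f‖ ^ 2)) :=
    (tendsto_id.mul_const _).mono_left nhdsWithin_le_nhds
  simpa using ge_of_tendsto hlim hle

theorem one_le_norm_one_sub_of_forall_norm_le_norm_sub_smul {x f : E}
    (hx : ∀ s : ℝ, ‖x‖ ≤ ‖x - s • f‖) (t : ℂ) :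
    1 ≤ ‖1 - (t • (algebraMap ℝ A (‖x‖ ^ 2) - ⟪x, x⟫_A) + ⟪x, f⟫_A)‖ := by
  set b : A := algebraMap ℝ A (‖x‖ ^ 2) - ⟪x, x⟫_A
  have hbsa : star b = b :=
    ((IsSelfAdjoint.all _).algebraMap A |>.sub CStarModule.isSelfAdjoint_inner_self).star_eq
  have hre : t • b + ⟪x, f⟫_A + star (t • b + ⟪x, f⟫_A) =
      (2 * t.re) • b + (⟪x, f⟫_A + ⟪f, x⟫_A) := by
    rw [star_add, star_smul, hbsa, CStarModule.star_inner, ← Complex.coe_smul, ← Complex.add_conj,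
      Complex.star_def]
    module
  have hnonpos := nonpos_of_forall_norm_le_norm_sub_smul hx
    (hre ▸ algebraMap_le_add_star_self (t • b + ⟪x, f⟫_A))
  linarith

theorem exists_state_apply_inner_self_eq_norm_sq_and_forall_apply_inner_eq_zero
    {F : Submodule ℂ E} {x : E} (hx : ∀ f ∈ F, ‖x‖ ≤ ‖x - f‖) :
    ∃ φ ∈ CStarState A, φ ⟪x, x⟫_A = (‖x‖ ^ 2 : ℝ) ∧ ∀ f ∈ F, φ ⟪x, f⟫_A = 0 := by
  set b : A := algebraMap ℝ A (‖x‖ ^ 2) - ⟪x, x⟫_A with hb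
  let V : Submodule ℂ A := Submodule.span ℂ {b} ⊔ F.map (CStarModule.innerₛₗ x)
  have hV : Metric.infDist 1 (V : Set A) = 1 := by
    refine le_antisymm ?_ ((Metric.le_infDist ⟨0, V.zero_mem⟩).mpr fun {v} hv => ?_)
    · simpa using Metric.infDist_le_dist_of_mem (x := (1 : A)) V.zero_mem
    · obtain ⟨t, f, hf, rfl⟩ : ∃ t : ℂ, ∃ f ∈ F, t • b + ⟪x, f⟫_A = v := by
        simpa [V, Submodule.mem_sup, Submodule.mem_span_singleton, CStarModule.innerₛₗ_apply]
          using hv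
      rw [dist_eq_norm]
      exact one_le_norm_one_sub_of_forall_norm_le_norm_sub_smul
        (fun s => hx _ (F.smul_of_tower_mem s hf)) t
  obtain ⟨φ, hφ, hφV⟩ := exists_state_forall_apply_eq_zero V hV
  refine ⟨φ, hφ, ?_, fun f hf =>
    hφV _ (Submodule.mem_sup_right (Submodule.mem_map_of_mem (f := CStarModule.innerₛₗ x) hf))⟩
  have hφb : φ b = 0 := hφV b (Submodule.mem_sup_left (Submodule.mem_span_singleton_self b))
  rw [hb, map_sub, CStarState.apply_algebraMap hφ, sub_eq_zero] at hφb
  exact hφb.symm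

end HilbertModule

section BestApproximation

variable {E : Type*} [NormedAddCommGroup E] [NormedSpace ℂ E] {F : Submodule ℂ E} {e f₀ : E}

theorem IsBestApproximation.infDist_eq (h : IsBestApproximation F e f₀) :
    Metric.infDist e (F : Set E) = ‖e - f₀‖ := by
  refine le_antisymm ?_ ((Metric.le_infDist ⟨f₀, h.1⟩).mpr fun {f} hf => ?_)
  · exact (Metric.infDist_le_dist_of_mem h.1).trans_eq (dist_eq_norm e f₀)
  · exact (h.2 f hf).trans_eq (dist_eq_norm e f).symm

theorem IsBestApproximation.norm_sub_le_norm_sub_sub (h : IsBestApproximation F e f₀) {f : E}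
    (hf : f ∈ F) : ‖e - f₀‖ ≤ ‖e - f₀ - f‖ := by
  rw [sub_sub]
  exact h.2 _ (F.add_mem h.1 hf)

variable {A : Type*} [CStarAlgebra A] [PartialOrder A] [StarOrderedRing A] [SMul A E]
  [CStarModule A E]

theorem stateM_le_re_apply_inner_self (φ : A →ₚ[ℂ] ℂ) (F : Submodule ℂ E) (e f₀ : E) :
    stateM φ F e f₀ ≤ (φ ⟪e - f₀, e - f₀⟫_A).re := by
  refine csSup_le (stateDefects_nonempty φ F e f₀) ?_
  rintro _ ⟨S, -, rfl⟩
  exact sub_le_self _ (tsum_nonneg fun _ => sq_nonneg _)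

theorem stateM_eq_re_apply_inner_self {φ : A →ₚ[ℂ] ℂ} (h : ∀ f ∈ F, φ ⟪e - f₀, f⟫_A = 0) :
    stateM φ F e f₀ = (φ ⟪e - f₀, e - f₀⟫_A).re := by
  have hdefects : stateDefects φ F e f₀ = {(φ ⟪e - f₀, e - f₀⟫_A).re} := by
    refine (stateDefects_nonempty φ F e f₀).subset_singleton_iff.mp ?_
    rintro _ ⟨S, hS, rfl⟩
    have hzero (u : S) : ‖⟪stateMk φ E (e - f₀), (u : StateQuotient φ E)⟫_ℂ‖ ^ 2 = 0 := by
      obtain ⟨f, hf, hfu⟩ := hS.prop.1 u.2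
      rw [← hfu, state_inner_mk, h f hf, norm_zero, sq, mul_zero]
    rw [Set.mem_singleton_iff, tsum_congr hzero, tsum_zero, sub_zero]
  rw [stateM, hdefects, csSup_singleton]

end BestApproximation

theorem mainTheorem3 {A : Type*} [CStarAlgebra A] [PartialOrder A] [StarOrderedRing A]
    [Nontrivial A] {E : Type*} [NormedAddCommGroup E] [NormedSpace ℂ E] [SMul A E]
    [CStarModule A E] (F : Submodule ℂ E) (e f₀ : E) (hf₀ : IsBestApproximation F e f₀) :
    IsGreatest ((fun φ : A →ₚ[ℂ] ℂ => stateM φ F e f₀) '' CStarState A)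
      (Metric.infDist e (F : Set E) ^ 2) := by
  rw [hf₀.infDist_eq]
  constructor
  · obtain ⟨φ, hφ, hnorm, horth⟩ :=
      exists_state_apply_inner_self_eq_norm_sq_and_forall_apply_inner_eq_zero (A := A)
        fun f (hf : f ∈ F) => hf₀.norm_sub_le_norm_sub_sub hf
    refine ⟨φ, hφ, (stateM_eq_re_apply_inner_self horth).trans ?_⟩
    rw [hnorm, Complex.ofReal_re]
  · rintro _ ⟨φ, hφ, rfl⟩
    exact (stateM_le_re_apply_inner_self φ F e f₀).trans
      (CStarState.re_apply_inner_self_le_norm_sq hφ _)
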